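/- Let $A\subset\mathbb{Z}$ be a finite set with $|A|\geq 3$ and $\gcd_{a\in A}a=1$. For integers $N\geq1$ write $NA=\{a_1+\dots+a_N : a_i\in A\}$; let $H(A)\subset\mathbb{R}$ be the convex hull of $A$, let $\operatorname{ex}(H(A))$ be the set of its extreme points, and let $w(A)=\max_{a_1,a_2\in A}|a_1-a_2|$. For a finite set $B\subset\mathbb{Z}$ let $\Lambda_B$ be the subgroup of $\mathbb{Z}$ generated by $B$, let $C_B=\{\sum_{b\in B}c_b b: c_b\in\mathbb{R}_{\geq0}\}$, and put $$\mathcal{E}(B)=(C_B\cap\Lambda_B)\setminus\bigcup_{N\geq1}NB .$$ Let $N_{\mathrm{Str}}(A)$ be the least integer $n\geq1$ such that for all $N\geq n$ and all $a_0\in A$ $$NA=\bigl(N H(A)\cap(a_0N+\Lambda_{A-A})\bigr)\setminus\bigcup_{a\in\operatorname{ex}(H(A))}\bigl(aN-\mathcal{E}(a-A)\bigr),$$ and let $N_{\mathrm{Kh}}(A)$ be the least integer $n\geq1$ for which there is a polynomial $P\in\mathbb{Q}[X]$ of degree at most $1$ with $|NA|=P(N)$ for all $N\geq n$ (each is $\infty$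 if no such $n$ exists). Then $$N_{\mathrm{Str}}(A)\leq w(A)-1\quad\text{and}\quad N_{\mathrm{Kh}}(A)\leq w(A)-1 .$$ In particular both are finite, and both are at most $d!\,\operatorname{vol}(H(A))$ with $d=1$, that is, at most the length of the interval $H(A)$. -/

import Mathlib

namespace SumsetThreshold

/-- The `N`-fold sumset `NA = {a₁ + ⋯ + a_N : aᵢ ∈ A}` (not the dilate of `A` by `N`). -/
def sumset (A : Finset ℤ) (N : ℕ) : Finset ℤ :=
  (Fintype.piFinset fun _ : Fin N => A).image fun f => ∑ i, f i

/-- The width `w(A) = max |a₁ - a₂|` over `a₁, a₂ ∈ A`. -/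
def width (A : Finset ℤ) : ℕ :=
  (A ×ˢ A).sup fun p => (p.1 - p.2).natAbs

/-- The convex hull `H(A)`, as a subset of `ℝ`. -/
def hull (A : Finset ℤ) : Set ℝ :=
  convexHull ℝ ((fun a : ℤ => (a : ℝ)) '' (A : Set ℤ))

/-- The lattice `Λ_A` generated by `A`. -/
def lattice (A : Finset ℤ) : AddSubgroup ℤ :=
  AddSubgroup.closure (A : Set ℤ)

/-- The cone `C_A` generated by `A`: all `∑ c_a a` with real `c_a ≥ 0`. -/
def cone (A : Finset ℤ) : Set ℝ :=
  {x | ∃ c : ℤ → ℝ, (∀ a ∈ A, 0 ≤ c a) ∧ x = ∑ a ∈ A, c a * (a : ℝ)}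

/-- `𝒫(A)`, the union of the sumsets `NA` over `N ≥ 1`. -/
def sums (A : Finset ℤ) : Set ℤ :=
  {x | ∃ N : ℕ, 1 ≤ N ∧ x ∈ sumset A N}

/-- The exceptional set `ℰ(A) = (C_A ∩ Λ_A) \ 𝒫(A)`. -/
def exceptional (A : Finset ℤ) : Set ℤ :=
  {x | (x : ℝ) ∈ cone A ∧ x ∈ lattice A ∧ x ∉ sums A}

/-- The reflected translate `a - A`. -/
def reflect (a : ℤ) (A : Finset ℤ) : Finset ℤ :=
  A.image fun x => a - x

/-- The difference set `A - A`. -/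
def diffs (A : Finset ℤ) : Finset ℤ :=
  Finset.image₂ (fun x y => x - y) A A

/-- The set `(N H(A) ∩ (a₀ N + Λ_{A-A})) \ ⋃_{a ∈ ex(H(A))} (a N - ℰ(a - A))`. -/
def structureSet (A : Finset ℤ) (a₀ : ℤ) (N : ℕ) : Set ℤ :=
  {x | (∃ y ∈ hull A, (x : ℝ) = (N : ℝ) * y) ∧
       (∃ l ∈ lattice (diffs A), x = a₀ * (N : ℤ) + l) ∧
       ¬ ∃ a : ℤ, (a : ℝ) ∈ Set.extremePoints ℝ (hull A) ∧
          ∃ e ∈ exceptional (reflect a A), x = a * (N : ℤ) - e}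

/-- The structure identity for `NA`, for every choice of the base point `a₀ ∈ A`
(the right-hand side does not depend on that choice). -/
def HasStructure (A : Finset ℤ) (N : ℕ) : Prop :=
  ∀ a₀ ∈ A, (sumset A N : Set ℤ) = structureSet A a₀ N

/-- `N_Str(A)`: the least positive integer `n` such that the structure identity holds for all
`N ≥ n`. The value is `⊤` if there is no such `n`. -/
noncomputable def NStr (A : Finset ℤ) : ℕ∞ :=
  ⨅ n ∈ {n : ℕ | 1 ≤ n ∧ ∀ N : ℕ, n ≤ N → HasStructure A N}, (n : ℕ∞)

/-- `N_Kh(A)`: the least positive integer `n` such that for some rational polynomial `P` of degree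
at most `1` (the dimension) one has `|NA| = P(N)` for all `N ≥ n`.
The value is `⊤` if there is no such `n`. -/
noncomputable def NKh (A : Finset ℤ) : ℕ∞ :=
  ⨅ n ∈ {n : ℕ | 1 ≤ n ∧ ∃ P : Polynomial ℚ, P.degree ≤ 1 ∧
      ∀ N : ℕ, n ≤ N → ((sumset A N).card : ℚ) = P.eval (N : ℚ)}, (n : ℕ∞)

end SumsetThreshold

/-! Translate so that `0` and `b = w(A)` are the extreme elements of `B ⊆ [0, b]`. Everything rests
on a cancellation law (`IsSumOf.of_add_zero_of_add_top`): for `n ≥ b - 1`, if `y` and `y + b` both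
lie in `(n+1)B`, then `y ∈ nB`. If not, adjoining `0` to a representation of `y + b` and `b` to one
of `y` gives two representations of `y + b` of length `n + 2`, and no exchange between them can
produce one containing both `0` and `b`, since deleting that pair would put `y` in `nB`. A walk
modulo `b`, subtracting right elements from left ones, then yields `n + 2` distinct residues
(`UnmixedPair.card_le`), so `n + 2 ≤ b`, a contradiction.

Applied on a grid, the law shows that membership allowed at both endpoints, with any number of
summands, already holds at level `N ≥ b - 1` (`IsSumOf.of_eventually`); this is the structure
identity. It also shows that `(N+1)B` minus `NB + b` has one element in each occupied class modulo
`b`; the number of classes is constant for `N ≥ b - 1`, so `|NA|` is linear there. -/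

namespace SumsetThreshold

/-! ### Unmixed pairs and the walk modulo `b` -/

/-- Two multisets `U + p • {0}` and `V + q • {b}` of integers in `[0, b]` with equal sums and equal
cardinalities, such that no multiset obtained by exchanging parts of them contains both `0` and
`b`. -/
structure UnmixedPair (b : ℤ) (U V : Multiset ℤ) (p q : ℕ) : Prop where
  left_mem : ∀ u ∈ U, 0 < u ∧ u < b
  right_mem : ∀ v ∈ V, 0 < v ∧ v < b
  left_pos : 1 ≤ p
  right_pos : 1 ≤ q
  sum_eq : U.sum = V.sum + b * q
  card_eq : U.card + p = V.card + q
  -- Trading `A` and `f` zeros for `C` and `t` copies of `b` preserves length iff `f = C.card + t -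
  -- A.card`. A trade bringing in some `b` must use up all zeros, and conversely.
  left_exchange : ∀ A ≤ U, ∀ C ≤ V, ∀ t : ℤ, A.sum - C.sum = b * t → 1 ≤ t →
    (p : ℤ) ≤ C.card + t - A.card
  right_exchange : ∀ A ≤ U, ∀ C ≤ V, ∀ t : ℤ, A.sum - C.sum = b * t →
    1 ≤ (C.card : ℤ) + t - A.card → (q : ℤ) ≤ t

/-- A walk in `[0, b)` that has visited the points of `X` and is now at `s`; it has consumed
`U₁`, `V₁`, and `U₂`, `V₂`, `p'` zeros and `q'` copies of `b` remain. -/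
structure WalkState (b : ℤ) (U V : Multiset ℤ) (p q : ℕ) (X : Finset ℤ) (s : ℤ)
    (U₁ V₁ U₂ V₂ : Multiset ℤ) (p' q' : ℕ) : Prop where
  left_eq : U₁ + U₂ = U
  right_eq : V₁ + V₂ = V
  sum_eq : s + U₂.sum = V₂.sum + b * q'
  card_eq : U₂.card + p' = V₂.card + q'
  nonneg : 0 ≤ s
  lt : s < b
  left_le : p' ≤ p
  right_le : q' ≤ q
  card_visited : X.card + U₂.card + p' = U.card + p
  visited_mem : ∀ x ∈ X, 0 ≤ x ∧ x < b
  from_start : ∀ x ∈ X, ∃ A ≤ U₁, ∃ C ≤ V₁, ∃ t : ℤ, A.sum - C.sum = x + b * t ∧ 0 ≤ t ∧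
    t + q' ≤ q ∧ 0 ≤ (C.card : ℤ) + t - A.card ∧ (C.card : ℤ) + t - A.card + p' ≤ p
  to_current : ∀ x ∈ X, ∃ A ≤ U₁, ∃ C ≤ V₁, ∃ t : ℤ, x + A.sum - C.sum = s + b * t ∧ 0 ≤ t ∧
    t + q' ≤ q ∧ 0 ≤ (C.card : ℤ) + t - A.card ∧ (C.card : ℤ) + t - A.card + p' ≤ p ∧
    (t = 0 → (C.card : ℤ) + t - A.card = 0 → x < s)

theorem multiset_sum_bounds {b : ℤ} {A : Multiset ℤ} (hA : ∀ a ∈ A, 0 < a ∧ a < b) :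
    (A.card : ℤ) ≤ A.sum ∧ A.sum ≤ (b - 1) * A.card := by
  induction A using Multiset.induction_on with
  | empty => simp
  | cons a A ih =>
    have h1 := ih fun x hx => hA x (Multiset.mem_cons_of_mem hx)
    have h2 := hA a (Multiset.mem_cons_self a A)
    simp only [Multiset.card_cons, Multiset.sum_cons]
    push_cast
    constructor
    · linarith
    · nlinarith

/-- Pigeonhole: the negated prefix sums of `l` modulo `b` are distinct from each other and from the
points of `X`. -/
theorem card_add_length_le {b : ℤ} (hb : 0 < b) (X : Finset ℤ) (hX : ∀ x ∈ X, 0 ≤ x ∧ x < b)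
    (l : List ℤ)
    (hblock : ∀ m, m ≠ [] → m <:+: l → ¬ b ∣ m.sum)
    (hprefix : ∀ x ∈ X, ∀ m, m ≠ [] → m <:+: l → ¬ b ∣ x + m.sum) :
    (X.card : ℤ) + l.length ≤ b := by
  classical
  let g : ℕ → ℤ := fun j => (-(l.take (j + 1)).sum) % b
  have hg : ∀ j, 0 ≤ g j ∧ g j < b := fun j =>
    ⟨Int.emod_nonneg _ hb.ne', Int.emod_lt_of_pos _ hb⟩
  have key : ∀ i j, i < j → j < l.length → g i ≠ g j := by
    intro i j hij hj h
    have h1 : b ∣ -(l.take (i + 1)).sum - -(l.take (j + 1)).sum :=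
      Int.dvd_of_emod_eq_zero (Int.emod_eq_emod_iff_emod_sub_eq_zero.1 h)
    have h2 : (l.take (j + 1)).sum = (l.take (i + 1)).sum + ((l.take (j + 1)).drop (i + 1)).sum := by
      conv_lhs => rw [← List.take_append_drop (i + 1) (l.take (j + 1))]
      rw [List.sum_append, List.take_take, min_eq_left (by omega)]
    refine hblock ((l.take (j + 1)).drop (i + 1)) ?_ ?_ ?_
    · intro h0
      have := congrArg List.length h0
      simp at this
      omega
    · exact (List.drop_suffix _ _).isInfix.trans (List.take_prefix _ _).isInfix
    · have : -(l.take (i + 1)).sum - -(l.take (j + 1)).sum =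
          ((l.take (j + 1)).drop (i + 1)).sum := by rw [h2]; ring
      rwa [this] at h1
  have hinj : Set.InjOn g (Finset.range l.length : Set ℕ) := by
    intro i hi j hj h
    simp only [Finset.coe_range, Set.mem_Iio] at hi hj
    rcases lt_trichotomy i j with hij | hij | hij
    · exact (key i j hij hj h).elim
    · exact hij
    · exact (key j i hij hi h.symm).elim
  have hdisj : Disjoint X ((Finset.range l.length).image g) := by
    rw [Finset.disjoint_left]
    intro x hx hx'
    obtain ⟨j, hj, rfl⟩ := Finset.mem_image.1 hx'
    refine hprefix _ hx (l.take (j + 1)) ?_ (List.take_prefix _ _).isInfix ?_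
    · intro h0
      have := congrArg List.length h0
      simp at this hj
      subst this
      simp at hj
    · have := Int.emod_add_mul_ediv (-(l.take (j + 1)).sum) b
      exact ⟨-(-(l.take (j + 1)).sum / b), by simp only [g]; linarith⟩
  have hsub : X ∪ (Finset.range l.length).image g ⊆ Finset.Ico 0 b := by
    intro x hx
    rcases Finset.mem_union.1 hx with h | h
    · exact Finset.mem_Ico.2 (hX x h)
    · obtain ⟨j, -, rfl⟩ := Finset.mem_image.1 h
      exact Finset.mem_Ico.2 (hg j)
  have hcard := Finset.card_le_card hsub
  rw [Finset.card_union_of_disjoint hdisj, Finset.card_image_of_injOn hinj, Finset.card_range,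
    Int.card_Ico] at hcard
  omega

namespace WalkState

variable {b : ℤ} {U V : Multiset ℤ} {p q : ℕ} {X : Finset ℤ} {s : ℤ}
  {U₁ V₁ U₂ V₂ : Multiset ℤ} {p' q' : ℕ}

theorem current_from_start (hP : UnmixedPair b U V p q)
    (h : WalkState b U V p q X s U₁ V₁ U₂ V₂ p' q') :
    U₁.sum - V₁.sum = s + b * ((q : ℤ) - q') ∧
      (V₁.card : ℤ) + ((q : ℤ) - q') - U₁.card + p' = p := by
  have h1 := hP.sum_eq
  have h2 := hP.card_eq
  have h3 := h.sum_eq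
  have h4 := h.card_eq
  rw [← h.left_eq, ← h.right_eq, Multiset.sum_add, Multiset.sum_add] at h1
  rw [← h.left_eq, ← h.right_eq, Multiset.card_add, Multiset.card_add] at h2
  constructor
  · linear_combination h1 - h3
  · omega

/-- A closed loop is an exchange. If it uses some `0` or `b`, the two exchange conditions force each
other and exhaust both supplies, against `1 ≤ p' + q'`; if it uses neither, the walk has strictly
increased. -/
theorem notMem_visited (hP : UnmixedPair b U V p q)
    (h : WalkState b U V p q X s U₁ V₁ U₂ V₂ p' q') (hpos : 1 ≤ p' + q') : s ∉ X := by
  intro hs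
  obtain ⟨A, hA, C, hC, t, hsum, ht, htq, hf, hfp, hlt⟩ := h.to_current s hs
  have hA' : A ≤ U := hA.trans (h.left_eq ▸ Multiset.le_add_right _ _)
  have hC' : C ≤ V := hC.trans (h.right_eq ▸ Multiset.le_add_right _ _)
  have h1 := hP.left_exchange A hA' C hC' t (by linarith)
  have h2 := hP.right_exchange A hA' C hC' t (by linarith)
  have hp := hP.left_pos
  have hq := hP.right_pos
  by_cases h0 : t = 0 ∧ (C.card : ℤ) + t - A.card = 0
  · exact lt_irrefl _ (hlt h0.1 h0.2)
  · omega

/-- `hc1` makes the move consume exactly one left element, zeros included, so visited points plus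
remaining left elements stay constant in number. -/
theorem step (hP : UnmixedPair b U V p q) {U₃ V₃ D E : Multiset ℤ} {s' : ℤ} {p'' q'' : ℕ}
    (h : WalkState b U V p q X s U₁ V₁ U₂ V₂ p' q') (hpos : 1 ≤ p' + q')
    (hD : D + U₃ = U₂) (hE : E + V₃ = V₂) (hp : p'' ≤ p') (hq : q'' ≤ q')
    (hs : s + D.sum - E.sum = s' + b * ((q' : ℤ) - q''))
    (hc : (E.card : ℤ) + ((q' : ℤ) - q'') - D.card = p' - p'')
    (hc1 : (D.card : ℤ) + (p' - p'') = 1)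
    (hs0 : 0 ≤ s') (hsb : s' < b) (hlt : p'' = p' → q'' = q' → s < s') :
    WalkState b U V p q (insert s X) s' (U₁ + D) (V₁ + E) U₃ V₃ p'' q'' := by
  have hD' : U₂.sum = D.sum + U₃.sum := by rw [← hD, Multiset.sum_add]
  have hE' : V₂.sum = E.sum + V₃.sum := by rw [← hE, Multiset.sum_add]
  have hDc : U₂.card = D.card + U₃.card := by rw [← hD, Multiset.card_add]
  have hEc : V₂.card = E.card + V₃.card := by rw [← hE, Multiset.card_add]
  have h1 := h.sum_eq
  have h2 := h.card_eq
  have h3 := h.left_le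
  have h4 := h.right_le
  have h5 := h.card_visited
  have hst := h.current_from_start hP
  refine ⟨?_, ?_, ?_, ?_, hs0, hsb, by omega, by omega, ?_, ?_, ?_, ?_⟩
  · rw [add_assoc, hD, h.left_eq]
  · rw [add_assoc, hE, h.right_eq]
  · linear_combination h1 - hD' + hE' - hs
  · omega
  · rw [Finset.card_insert_of_notMem (h.notMem_visited hP hpos)]
    omega
  · intro x hx
    rcases Finset.mem_insert.1 hx with rfl | hx
    · exact ⟨h.nonneg, h.lt⟩
    · exact h.visited_mem x hx
  · intro x hx
    rcases Finset.mem_insert.1 hx with rfl | hx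
    · exact ⟨U₁, Multiset.le_add_right _ _, V₁, Multiset.le_add_right _ _, (q : ℤ) - q', hst.1,
        by omega, by omega, by omega, by omega⟩
    · obtain ⟨A, hA, C, hC, t, hsum, ht, htq, hf, hfp⟩ := h.from_start x hx
      exact ⟨A, hA.trans (Multiset.le_add_right _ _), C, hC.trans (Multiset.le_add_right _ _), t,
        hsum, ht, by omega, hf, by omega⟩
  · intro x hx
    rcases Finset.mem_insert.1 hx with rfl | hx
    · refine ⟨D, Multiset.le_add_left _ _, E, Multiset.le_add_left _ _, (q' : ℤ) - q'', hs,
        by omega, by omega, by omega, by omega, fun ht hf => hlt (by omega) (by omega)⟩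
    · obtain ⟨A, hA, C, hC, t, hsum, ht, htq, hf, hfp, hxs⟩ := h.to_current x hx
      refine ⟨A + D, Multiset.add_le_add_right hA, C + E, Multiset.add_le_add_right hC,
        t + ((q' : ℤ) - q''), ?_, by omega, by omega, ?_, ?_, ?_⟩
      · simp only [Multiset.sum_add]
        linear_combination hsum + hs
      · simp only [Multiset.card_add]
        push_cast
        omega
      · simp only [Multiset.card_add]
        push_cast
        omega
      · simp only [Multiset.card_add]
        push_cast
        intro ht' hf'
        exact (hxs (by omega) (by omega)).trans (hlt (by omega) (by omega))

theorem exists_from_start (hP : UnmixedPair b U V p q)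
    (h : WalkState b U V p q X s U₁ V₁ U₂ V₂ p' q') {x : ℤ} (hx : x ∈ insert s X) :
    ∃ A ≤ U₁, ∃ C ≤ V₁, ∃ t : ℤ, A.sum - C.sum = x + b * t ∧ 0 ≤ t ∧
      t + q' ≤ q ∧ 0 ≤ (C.card : ℤ) + t - A.card ∧ (C.card : ℤ) + t - A.card + p' ≤ p := by
  rcases Finset.mem_insert.1 hx with rfl | hx
  · have hst := h.current_from_start hP
    have h3 := h.left_le
    have h4 := h.right_le
    exact ⟨U₁, le_rfl, V₁, le_rfl, (q : ℤ) - q', hst.1, by omega, by omega, by omega, by omega⟩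
  · exact h.from_start x hx

end WalkState

theorem coe_le_of_infix_toList {M : Multiset ℤ} {m : List ℤ} (hm : m <:+: M.toList) :
    (m : Multiset ℤ) ≤ M := by
  rw [← Multiset.coe_toList M, Multiset.coe_le]
  exact hm.sublist.subperm

namespace WalkState

variable {b : ℤ} {U V : Multiset ℤ} {p q : ℕ} {X : Finset ℤ} {s : ℤ}
  {U₁ V₁ U₂ V₂ : Multiset ℤ} {p' q' : ℕ}

theorem base (hP : UnmixedPair b U V p q) (hb : 0 < b) :
    WalkState b U V p q ∅ 0 0 0 U V p q where
  left_eq := zero_add _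
  right_eq := zero_add _
  sum_eq := by rw [zero_add]; exact hP.sum_eq
  card_eq := hP.card_eq
  nonneg := le_rfl
  lt := hb
  left_le := le_rfl
  right_le := le_rfl
  card_visited := by simp
  visited_mem := by simp
  from_start := by simp
  to_current := by simp

theorem visited_mem_insert (h : WalkState b U V p q X s U₁ V₁ U₂ V₂ p' q') :
    ∀ x ∈ insert s X, 0 ≤ x ∧ x < b := by
  intro x hx
  rcases Finset.mem_insert.1 hx with rfl | hx
  · exact ⟨h.nonneg, h.lt⟩
  · exact h.visited_mem x hx

theorem one_le_mult {b n w : ℤ} (hb : 0 < b) (h : b * w = n) (hn : 0 < n) : 1 ≤ w := by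
  by_contra hw
  nlinarith

/-- With one zero left, the unused elements of `U` supply the missing residues: a block closing up
modulo `b` would be an exchange that brings in some `b` and spares a zero. -/
theorem card_le_of_zero_last (hP : UnmixedPair b U V p q)
    (h : WalkState b U V p q X s U₁ V₁ U₂ V₂ 1 0) : ((U.card + p : ℕ) : ℤ) ≤ b := by
  have hb : 0 < b := h.nonneg.trans_lt h.lt
  have hp := hP.left_pos
  have hbound : ∀ m : List ℤ, m ≠ [] → m <:+: U₂.toList →
      (m : Multiset ℤ) ≤ U₂ ∧ 1 ≤ (m.length : ℤ) ∧ (m.length : ℤ) ≤ m.sum ∧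
        m.sum ≤ (b - 1) * m.length := by
    intro m hm hml
    have hle := coe_le_of_infix_toList hml
    have hle' : (m : Multiset ℤ) ≤ U := hle.trans (h.left_eq ▸ Multiset.le_add_left _ _)
    have := multiset_sum_bounds (b := b) (A := (m : Multiset ℤ))
      fun a ha => hP.left_mem a (Multiset.mem_of_le hle' ha)
    rw [Multiset.coe_card, Multiset.sum_coe] at this
    have hpos := List.length_pos_of_ne_nil hm
    exact ⟨hle, by omega, this⟩
  have := card_add_length_le hb (insert s X) h.visited_mem_insert U₂.toList ?_ ?_
  · rw [Finset.card_insert_of_notMem (h.notMem_visited hP (by norm_num)),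
      Multiset.length_toList] at this
    have h5 := h.card_visited
    omega
  · rintro m hm hml ⟨w, hw⟩
    obtain ⟨hle, hl, h1, h2⟩ := hbound m hm hml
    have hw1 := one_le_mult hb hw.symm (by omega)
    have := hP.left_exchange m (hle.trans (h.left_eq ▸ Multiset.le_add_left _ _)) 0
      (Multiset.zero_le _) w (by simpa using hw) hw1
    simp only [Multiset.card_zero, Multiset.coe_card] at this
    push_cast at this
    nlinarith
  · rintro x hx m hm hml ⟨w, hw⟩
    obtain ⟨hle, hl, h1, h2⟩ := hbound m hm hml
    have hxb := h.visited_mem_insert x hx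
    have hw1 := one_le_mult hb hw.symm (by omega)
    obtain ⟨A, hA, C, hC, t, hsum, ht, htq, hf, hfp⟩ := h.exists_from_start hP hx
    have := hP.left_exchange (A + m) (h.left_eq ▸ add_le_add hA hle) C
      (hC.trans (h.right_eq ▸ Multiset.le_add_right _ _)) (t + w)
      (by rw [Multiset.sum_add, Multiset.sum_coe]; linear_combination hsum + hw) (by omega)
    simp only [Multiset.card_add, Multiset.coe_card] at this
    push_cast at this hfp
    -- The exchange must spend the last zero, while `x < b` and `m.sum ≤ (b - 1) * m.length` give `w
    -- ≤ m.length`.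
    have hwm : (m.length : ℤ) + 1 ≤ w := by omega
    nlinarith

/-- Mirror image: one copy of `b` is left, and the residues come from subtracting the unused
elements of `V`. -/
theorem card_le_of_top_last (hP : UnmixedPair b U V p q)
    (h : WalkState b U V p q X s U₁ V₁ U₂ V₂ 0 1) : ((U.card + p : ℕ) : ℤ) ≤ b := by
  have hb : 0 < b := h.nonneg.trans_lt h.lt
  have hq := hP.right_pos
  have hbound : ∀ m : List ℤ, m ≠ [] → m <:+: V₂.toList.map Neg.neg →
      ∃ m' : List ℤ, m.sum = -m'.sum ∧ (m' : Multiset ℤ) ≤ V₂ ∧ 1 ≤ (m'.length : ℤ) ∧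
        (m'.length : ℤ) ≤ m'.sum ∧ m'.sum ≤ (b - 1) * m'.length := by
    intro m hm hml
    have hml' := hml.map Neg.neg
    rw [List.map_map, neg_comp_neg, List.map_id] at hml'
    have hle := coe_le_of_infix_toList hml'
    have hle' := hle.trans (h.right_eq ▸ Multiset.le_add_left _ _ : V₂ ≤ V)
    have := multiset_sum_bounds (b := b) (A := (m.map Neg.neg : List ℤ))
      fun a ha => hP.right_mem a (Multiset.mem_of_le hle' ha)
    rw [Multiset.coe_card, Multiset.sum_coe] at this
    have hpos := List.length_pos_of_ne_nil hm
    refine ⟨m.map Neg.neg, ?_, hle, by rw [List.length_map]; omega, this⟩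
    have := List.sum_neg m
    rw [← this, neg_neg]
  have := card_add_length_le hb (insert s X) h.visited_mem_insert (V₂.toList.map Neg.neg) ?_ ?_
  · rw [Finset.card_insert_of_notMem (h.notMem_visited hP (by norm_num)), List.length_map,
      Multiset.length_toList] at this
    have h5 := h.card_visited
    have h6 := h.card_eq
    omega
  · rintro m hm hml ⟨w, hw⟩
    obtain ⟨m, hneg, hle, hl, h1, h2⟩ := hbound m hm hml
    have hw1 : w ≤ -1 := by
      have := one_le_mult (w := -w) hb (n := m.sum) (by linarith) (by omega)
      omega
    have hwm : 1 ≤ (m.length : ℤ) + w := by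
      by_contra hc
      have : (m.length : ℤ) ≤ -w := by omega
      nlinarith
    have := hP.right_exchange 0 (Multiset.zero_le _) m
      (hle.trans (h.right_eq ▸ Multiset.le_add_left _ _)) w
      (by rw [Multiset.sum_zero, Multiset.sum_coe]; linarith)
      (by simpa using hwm)
    omega
  · rintro x hx m hm hml ⟨w, hw⟩
    obtain ⟨m, hneg, hle, hl, h1, h2⟩ := hbound m hm hml
    have hxb := h.visited_mem_insert x hx
    have hw1 : w ≤ 0 := by
      by_contra hc
      have : 1 ≤ w := by omega
      nlinarith
    have hwm : 1 ≤ (m.length : ℤ) + w := by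
      by_contra hc
      have : (m.length : ℤ) ≤ -w := by omega
      nlinarith
    obtain ⟨A, hA, C, hC, t, hsum, ht, htq, hf, hfp⟩ := h.exists_from_start hP hx
    have := hP.right_exchange A (hA.trans (h.left_eq ▸ Multiset.le_add_right _ _)) (C + m)
      (h.right_eq ▸ add_le_add hC hle) (t + w)
      (by rw [Multiset.sum_add, Multiset.sum_coe]; linear_combination hsum + hw - hneg)
      (by
        simp only [Multiset.card_add, Multiset.coe_card]
        push_cast
        omega)
    omega

/-- While more than one special element remains, one of the moves `u - b`, `0 - v`, or `u - v` with
`v < u` keeps the walk in `[0, b)`. No move `0 - b` occurs and each move spends at most one special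
element, so the walk reaches a state with exactly one left. -/
theorem card_le (hP : UnmixedPair b U V p q)
    (h : WalkState b U V p q X s U₁ V₁ U₂ V₂ p' q') (hpos : 1 ≤ p' + q') :
    ((U.card + p : ℕ) : ℤ) ≤ b := by
  induction hn : U₂.card + V₂.card using Nat.strong_induction_on
    generalizing X s U₁ V₁ U₂ V₂ p' q' with
  | _ n ih =>
  have hs0 := h.nonneg
  have hsb := h.lt
  have hsum := h.sum_eq
  have hcard := h.card_eq
  have hU : ∀ u ∈ U₂, 0 < u ∧ u < b := fun u hu =>
    hP.left_mem u (h.left_eq ▸ Multiset.mem_add.2 (Or.inr hu))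
  have hV : ∀ v ∈ V₂, 0 < v ∧ v < b := fun v hv =>
    hP.right_mem v (h.right_eq ▸ Multiset.mem_add.2 (Or.inr hv))
  by_cases hz : p' = 1 ∧ q' = 0
  · obtain ⟨rfl, rfl⟩ := hz
    exact h.card_le_of_zero_last hP
  by_cases ht : p' = 0 ∧ q' = 1
  · obtain ⟨rfl, rfl⟩ := ht
    exact h.card_le_of_top_last hP
  by_cases ha : 1 ≤ q' ∧ ∃ u ∈ U₂, b ≤ s + u
  · obtain ⟨hq', u, hu, hbu⟩ := ha
    obtain ⟨U₃, rfl⟩ := Multiset.exists_cons_of_mem hu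
    have hub := hU u hu
    refine ih (U₃.card + V₂.card) ?_ (h.step hP hpos (D := {u}) (E := 0) (U₃ := U₃) (V₃ := V₂)
      (s' := s + u - b) (p'' := p') (q'' := q' - 1) rfl (zero_add _) le_rfl (by omega) ?_ ?_ ?_
      (by omega) (by omega) (by omega)) (by omega) rfl
    · rw [← hn, Multiset.card_cons]; omega
    · rw [Multiset.sum_singleton, Multiset.sum_zero, Nat.cast_sub hq']; push_cast; ring
    · rw [Multiset.card_singleton, Multiset.card_zero, Nat.cast_sub hq']; push_cast; ring
    · simp
  by_cases hb : 1 ≤ p' ∧ ∃ v ∈ V₂, v ≤ s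
  · obtain ⟨hp', v, hv, hsv⟩ := hb
    obtain ⟨V₃, rfl⟩ := Multiset.exists_cons_of_mem hv
    have hvb := hV v hv
    refine ih (U₂.card + V₃.card) ?_ (h.step hP hpos (D := 0) (E := {v}) (U₃ := U₂) (V₃ := V₃)
      (s' := s - v) (p'' := p' - 1) (q'' := q') (zero_add _) rfl (by omega) le_rfl ?_ ?_ ?_
      (by omega) (by omega) (by omega)) (by omega) rfl
    · rw [← hn, Multiset.card_cons]; omega
    · rw [Multiset.sum_singleton, Multiset.sum_zero]; ring
    · rw [Multiset.card_singleton, Multiset.card_zero, Nat.cast_sub hp']; push_cast; ring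
    · rw [Multiset.card_zero, Nat.cast_sub hp']; push_cast; ring
  push Not at ha hb
  -- If `c` separates `U₂` from `V₂`, the balance equation bounds `s` from below; taking `c` to be
  -- the maximum of `U₂`, the minimum of `V₂`, or `b` contradicts the failure of the first two
  -- moves.
  have hthreshold : ∀ c : ℤ, (∀ u ∈ U₂, u ≤ c) → (∀ v ∈ V₂, c ≤ v) →
      c * p' + (b - c) * q' ≤ s := by
    intro c hu hv
    have h1 := Multiset.sum_le_card_nsmul U₂ c hu
    have h2 := Multiset.card_nsmul_le_sum (s := V₂) (a := c) hv
    rw [nsmul_eq_mul] at h1 h2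
    have h3 : (V₂.card : ℤ) = U₂.card + p' - q' := by omega
    rw [h3] at h2
    linarith
  obtain ⟨u, hu, v, hv, huv⟩ : ∃ u ∈ U₂, ∃ v ∈ V₂, v < u := by
    by_contra! hle
    rcases Nat.eq_zero_or_pos p' with hp0 | hp1
    · have hne : U₂ ≠ 0 := by
        rintro rfl
        simp at hcard
        omega
      obtain ⟨c, hc, hmax⟩ := Multiset.exists_max_image id hne
      have h1 := hthreshold c hmax (hle c hc)
      have h2 := ha (by omega) c hc
      have h3 := hU c hc
      have h4 : (1 : ℤ) ≤ q' := by omega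
      subst hp0
      push_cast at h1
      nlinarith
    · by_cases hne : V₂ = 0
      · subst hne
        have h1 := hthreshold b (fun u hu => (hU u hu).2.le) (by simp)
        have h4 : (1 : ℤ) ≤ p' := by omega
        nlinarith
      · obtain ⟨c, hc, hmin⟩ := Multiset.exists_min_image id hne
        have h1 := hthreshold c (fun u hu => hle u hu c hc) hmin
        have h2 := hb (by omega) c hc
        have h3 := hV c hc
        have h4 : (1 : ℤ) ≤ p' := by omega
        have h5 : 0 ≤ (b - c) * (q' : ℤ) := mul_nonneg (by omega) (by omega)
        nlinarith
  obtain ⟨U₃, rfl⟩ := Multiset.exists_cons_of_mem hu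
  obtain ⟨V₃, rfl⟩ := Multiset.exists_cons_of_mem hv
  have hub := hU u hu
  have hvb := hV v hv
  have hlt : s + u - v < b := by
    rcases Nat.eq_zero_or_pos q' with hq0 | hq1
    · have := hb (by omega) v hv
      omega
    · have := ha (by omega) u hu
      omega
  refine ih (U₃.card + V₃.card) ?_ (h.step hP hpos (D := {u}) (E := {v}) (U₃ := U₃) (V₃ := V₃)
    (s' := s + u - v) (p'' := p') (q'' := q') rfl rfl le_rfl le_rfl ?_ ?_ ?_
    (by omega) hlt (by omega)) hpos rfl
  · rw [← hn, Multiset.card_cons, Multiset.card_cons]; omega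
  · rw [Multiset.sum_singleton, Multiset.sum_singleton]; ring
  · rw [Multiset.card_singleton, Multiset.card_singleton]; ring
  · simp

end WalkState

theorem UnmixedPair.card_le {b : ℤ} {U V : Multiset ℤ} {p q : ℕ} (hP : UnmixedPair b U V p q)
    (hb : 0 < b) : ((U.card + p : ℕ) : ℤ) ≤ b :=
  (WalkState.base hP hb).card_le hP (by have := hP.left_pos; omega)

/-! ### Sumsets through multisets -/

/-- `x` is a sum of `N` elements of `B`, with repetition allowed. -/
def IsSumOf (B : Finset ℤ) (N : ℕ) (x : ℤ) : Prop :=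
  ∃ W : Multiset ℤ, (∀ a ∈ W, a ∈ B) ∧ W.card = N ∧ W.sum = x

theorem mem_sumset {A : Finset ℤ} {N : ℕ} {x : ℤ} : x ∈ sumset A N ↔ IsSumOf A N x := by
  simp only [sumset, Finset.mem_image, Fintype.mem_piFinset]
  constructor
  · rintro ⟨f, hf, rfl⟩
    refine ⟨Finset.univ.val.map f, ?_, by simp, rfl⟩
    intro a ha
    obtain ⟨i, -, rfl⟩ := Multiset.mem_map.1 ha
    exact hf i
  · rintro ⟨W, hW, rfl, rfl⟩
    induction W using Quotient.inductionOn with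
    | _ l =>
      exact ⟨fun i => l.get i, fun i => hW _ (List.get_mem l i), Fin.sum_univ_getElem l⟩

theorem IsSumOf.add_mem {B : Finset ℤ} {N : ℕ} {x a : ℤ} (h : IsSumOf B N x) (ha : a ∈ B) :
    IsSumOf B (N + 1) (x + a) := by
  obtain ⟨W, hW, hc, hs⟩ := h
  refine ⟨a ::ₘ W, ?_, by simp [hc], by simp [hs, add_comm]⟩
  intro y hy
  rcases Multiset.mem_cons.1 hy with rfl | hy
  · exact ha
  · exact hW y hy

theorem IsSumOf.map_affine {A B : Finset ℤ} {N : ℕ} {x c e : ℤ} (h : IsSumOf A N x)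
    (hAB : ∀ a ∈ A, c + e * a ∈ B) : IsSumOf B N (N * c + e * x) := by
  obtain ⟨W, hW, rfl, rfl⟩ := h
  refine ⟨W.map fun y => c + e * y, ?_, by simp, ?_⟩
  · intro y hy
    obtain ⟨a, ha, rfl⟩ := Multiset.mem_map.1 hy
    exact hAB a (hW a ha)
  · rw [Multiset.sum_map_add, Multiset.sum_map_mul_left]
    simp

theorem IsSumOf.add_nat_mul {B : Finset ℤ} {N : ℕ} {x a : ℤ} (h : IsSumOf B N x) (ha : a ∈ B)
    (k : ℕ) : IsSumOf B (N + k) (x + a * k) := by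
  induction k with
  | zero => simpa using h
  | succ k ih =>
    have := ih.add_mem ha
    rwa [add_assoc N, add_assoc x, ← mul_add_one, ← Nat.cast_add_one] at this

/-! ### The cancellation law and its iteration -/

section Normalized

variable {B : Finset ℤ} {b : ℤ}

theorem UnmixedPair.of_not_isSumOf (h0 : (0 : ℤ) ∈ B) (hbB : b ∈ B)
    (hB : ∀ x ∈ B, 0 ≤ x ∧ x ≤ b) {n : ℕ} {z : ℤ} {U V : Multiset ℤ} {p q : ℕ}
    (hU : ∀ u ∈ U, u ∈ B) (hV : ∀ v ∈ V, v ∈ B) (hU0 : 0 ∉ U) (hUb : b ∉ U) (hV0 : 0 ∉ V)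
    (hVb : b ∉ V) (hp : 1 ≤ p) (hq : 1 ≤ q) (hUs : U.sum = z) (hUc : U.card + p = n + 2)
    (hVs : V.sum + b * q = z) (hVc : V.card + q = n + 2) (hn : ¬ IsSumOf B n (z - b)) :
    UnmixedPair b U V p q := by
  -- Deleting one `0` and one `b` from a mixed representation of `z` leaves `n` elements with sum `z
  -- - b`.
  have mixed : ∀ (M : Multiset ℤ) (i j : ℤ), (∀ a ∈ M, a ∈ B) → 1 ≤ i → 1 ≤ j →
      (M.card : ℤ) + i + j = n + 2 → M.sum + b * j = z → False := by
    intro M i j hM hi hj hc hs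
    lift i to ℕ using by omega
    lift j to ℕ using by omega
    refine hn ⟨M + (Multiset.replicate (i - 1) 0 + Multiset.replicate (j - 1) b), ?_, ?_, ?_⟩
    · intro a ha
      simp only [Multiset.mem_add, Multiset.mem_replicate] at ha
      rcases ha with ha | ⟨-, rfl⟩ | ⟨-, rfl⟩
      · exact hM a ha
      · exact h0
      · exact hbB
    · simp only [Multiset.card_add, Multiset.card_replicate]
      omega
    · simp only [Multiset.sum_add, Multiset.sum_replicate, nsmul_eq_mul]
      rw [← hs, Nat.cast_sub (show 1 ≤ i by omega), Nat.cast_sub (show 1 ≤ j by omega)]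
      push_cast
      ring
  have inner : ∀ M : Multiset ℤ, (∀ a ∈ M, a ∈ B) → 0 ∉ M → b ∉ M → ∀ a ∈ M, 0 < a ∧ a < b := by
    intro M hM hM0 hMb a ha
    have := hB a (hM a ha)
    refine ⟨lt_of_le_of_ne this.1 ?_, lt_of_le_of_ne this.2 ?_⟩
    · rintro rfl; exact hM0 ha
    · rintro rfl; exact hMb ha
  refine ⟨inner U hU hU0 hUb, inner V hV hV0 hVb, hp, hq, by rw [hUs, hVs], by rw [hUc, hVc],
    ?_, ?_⟩
  · intro A hA C hC t hsum ht
    obtain ⟨A', rfl⟩ := Multiset.le_iff_exists_add.1 hA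
    by_contra! hlt
    refine mixed (A' + C) (p - (C.card + t - A.card)) t ?_ (by omega) ht ?_ ?_
    · intro a ha
      rcases Multiset.mem_add.1 ha with ha | ha
      · exact hU a (Multiset.mem_add.2 (Or.inr ha))
      · exact hV a (Multiset.mem_of_le hC ha)
    · simp only [Multiset.card_add] at hUc ⊢
      push_cast
      omega
    · rw [Multiset.sum_add] at hUs ⊢
      linarith
  · intro A hA C hC t hsum hf
    obtain ⟨C', rfl⟩ := Multiset.le_iff_exists_add.1 hC
    by_contra! hlt
    refine mixed (C' + A) (C.card + t - A.card) (q - t) ?_ hf (by omega) ?_ ?_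
    · intro a ha
      rcases Multiset.mem_add.1 ha with ha | ha
      · exact hV a (Multiset.mem_add.2 (Or.inr ha))
      · exact hU a (Multiset.mem_of_le hA ha)
    · simp only [Multiset.card_add] at hVc ⊢
      push_cast
      omega
    · rw [Multiset.sum_add] at hVs ⊢
      linarith

theorem IsSumOf.of_add_zero_of_add_top (hb : 0 < b) (h0 : (0 : ℤ) ∈ B) (hbB : b ∈ B)
    (hB : ∀ x ∈ B, 0 ≤ x ∧ x ≤ b) {n : ℕ} (hn : b ≤ n + 1) {y : ℤ}
    (h₁ : IsSumOf B (n + 1) (y + b)) (h₂ : IsSumOf B (n + 1) y) : IsSumOf B n y := by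
  by_contra hcon
  obtain ⟨W₁, hW₁, hc₁, hs₁⟩ := h₁
  obtain ⟨W₂, hW₂, hc₂, hs₂⟩ := h₂
  have hb₁ : b ∉ W₁ := by
    intro h
    obtain ⟨W, rfl⟩ := Multiset.exists_cons_of_mem h
    simp only [Multiset.card_cons, Multiset.sum_cons] at hc₁ hs₁
    exact hcon ⟨W, fun a ha => hW₁ a (Multiset.mem_cons_of_mem ha), by omega, by omega⟩
  have h0₂ : (0 : ℤ) ∉ W₂ := by
    intro h
    obtain ⟨W, rfl⟩ := Multiset.exists_cons_of_mem h
    simp only [Multiset.card_cons, Multiset.sum_cons] at hc₂ hs₂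
    exact hcon ⟨W, fun a ha => hW₂ a (Multiset.mem_cons_of_mem ha), by omega, by omega⟩
  have e₁ := Multiset.filter_add_not (fun x => x = 0) W₁
  have e₂ := Multiset.filter_add_not (fun x => x = b) W₂
  rw [Multiset.filter_eq'] at e₁ e₂
  have c₁ := congrArg Multiset.card e₁
  have c₂ := congrArg Multiset.card e₂
  have s₁ := congrArg Multiset.sum e₁
  have s₂ := congrArg Multiset.sum e₂
  simp only [Multiset.card_add, Multiset.card_replicate] at c₁ c₂
  simp only [Multiset.sum_add, Multiset.sum_replicate, smul_zero, zero_add, nsmul_eq_mul] at s₁ s₂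
  -- The `+ 1` in `p` and `q` is the adjoined `0`, respectively `b`; both sides then have `n + 2`
  -- elements.
  have := (UnmixedPair.of_not_isSumOf h0 hbB hB (n := n) (z := y + b)
    (U := W₁.filter fun x => ¬ x = 0) (V := W₂.filter fun x => ¬ x = b)
    (p := W₁.count 0 + 1) (q := W₂.count b + 1)
    (fun u hu => hW₁ u (Multiset.mem_of_mem_filter hu))
    (fun v hv => hW₂ v (Multiset.mem_of_mem_filter hv))
    (by simp) (fun h => hb₁ (Multiset.mem_of_mem_filter h))
    (fun h => h0₂ (Multiset.mem_of_mem_filter h)) (by simp) (by omega) (by omega)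
    (by rw [s₁, hs₁]) (by omega)
    (by push_cast; linarith) (by omega) (by simpa using hcon)).card_le hb
  push_cast at this
  omega

/-- On the grid with entry `x + b * i ∈ (N + i + j)B` at `(i, j)`, padding by `b` fills the edge `j
= J` and padding by `0` the edge `i = I`. Cancellation deduces `(i, j)` from `(i, j + 1)` and `(i +
1, j)`, down to the origin. -/
theorem IsSumOf.of_eventually (hb : 0 < b) (h0 : (0 : ℤ) ∈ B) (hbB : b ∈ B)
    (hB : ∀ x ∈ B, 0 ≤ x ∧ x ≤ b) {N : ℕ} (hN : b ≤ N + 1) {x : ℤ} {I J : ℕ}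
    (h₁ : IsSumOf B (N + J) x) (h₂ : IsSumOf B (N + I) (x + b * I)) : IsSumOf B N x := by
  have hJ : ∀ i : ℕ, IsSumOf B (N + i + J) (x + b * i) := fun i => by
    convert h₁.add_nat_mul hbB i using 1
    omega
  have hI : ∀ j : ℕ, IsSumOf B (N + I + j) (x + b * I) := fun j => by
    simpa using h₂.add_nat_mul h0 j
  have hdesc : ∀ i j : ℕ, IsSumOf B (N + i + (j + 1)) (x + b * i) →
      IsSumOf B (N + (i + 1) + j) (x + b * (i + 1 : ℕ)) → IsSumOf B (N + i + j) (x + b * i) := by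
    intro i j h h'
    refine IsSumOf.of_add_zero_of_add_top hb h0 hbB hB (by push_cast; omega) ?_ h
    convert h' using 1
    · omega
    · push_cast; ring
  have hall : ∀ j ≤ J, ∀ i ≤ I, IsSumOf B (N + i + j) (x + b * i) := by
    intro j hj
    induction hj using Nat.decreasingInduction with
    | self => exact fun i _ => hJ i
    | of_succ j _ ihj =>
      intro i hi
      induction hi using Nat.decreasingInduction with
      | self => exact hI j
      | of_succ i hi ihi => exact hdesc i j (ihj i hi.le) ihi
  simpa using hall 0 (Nat.zero_le _) 0 (Nat.zero_le _)

end Normalized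

/-! ### Residue classes and linear growth of cardinality -/

section Normalized

variable {B : Finset ℤ} {b : ℤ}

/-- Among at least `b` summands some nonempty block has sum divisible by `b`; replace it by one
fewer zeros than its length. -/
theorem IsSumOf.exists_dvd_sub (hb : 0 < b) (h0 : (0 : ℤ) ∈ B) {K : ℕ} (hK : b ≤ K + 1) {z : ℤ}
    (h : IsSumOf B (K + 1) z) : ∃ y, IsSumOf B K y ∧ b ∣ z - y := by
  obtain ⟨W, hW, hc, rfl⟩ := h
  obtain ⟨m, hm, hml, hdvd⟩ : ∃ m, m ≠ [] ∧ m <:+: W.toList ∧ b ∣ m.sum := by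
    by_contra! hcon
    have := card_add_length_le hb {0} (by simpa using hb) W.toList hcon (by simpa using hcon)
    rw [Finset.card_singleton, Multiset.length_toList] at this
    omega
  obtain ⟨W', rfl⟩ := Multiset.le_iff_exists_add.1 (coe_le_of_infix_toList hml)
  have hpos := List.length_pos_of_ne_nil hm
  refine ⟨W'.sum, ⟨W' + Multiset.replicate (m.length - 1) 0, ?_, ?_, by simp⟩, by simpa using hdvd⟩
  · intro a ha
    rcases Multiset.mem_add.1 ha with ha | ha
    · exact hW a (Multiset.mem_add.2 (Or.inr ha))
    · rwa [Multiset.eq_of_mem_replicate ha]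
  · simp only [Multiset.card_add, Multiset.coe_card, Multiset.card_replicate] at hc ⊢
    omega

theorem image_emod_sumset_succ (hb : 0 < b) (h0 : (0 : ℤ) ∈ B) {K : ℕ} (hK : b ≤ K + 1) :
    (sumset B (K + 1)).image (· % b) = (sumset B K).image (· % b) := by
  ext r
  simp only [Finset.mem_image, mem_sumset]
  constructor
  · rintro ⟨z, hz, rfl⟩
    obtain ⟨y, hy, hdvd⟩ := hz.exists_dvd_sub hb h0 hK
    exact ⟨y, hy, (Int.emod_eq_emod_iff_emod_sub_eq_zero.2 (Int.emod_eq_zero_of_dvd hdvd)).symm⟩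
  · rintro ⟨y, hy, rfl⟩
    exact ⟨y, by simpa using hy.add_mem h0, rfl⟩

theorem card_sumset_succ (hb : 0 < b) (h0 : (0 : ℤ) ∈ B) (hbB : b ∈ B)
    (hB : ∀ x ∈ B, 0 ≤ x ∧ x ≤ b) {N : ℕ} (hN : b ≤ N + 1) :
    (sumset B (N + 1)).card = (sumset B N).card + ((sumset B N).image (· % b)).card := by
  set T := sumset B (N + 1) \ (sumset B N).image (· + b) with hT
  have hsub : (sumset B N).image (· + b) ⊆ sumset B (N + 1) := by
    intro z hz
    obtain ⟨y, hy, rfl⟩ := Finset.mem_image.1 hz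
    exact mem_sumset.2 ((mem_sumset.1 hy).add_mem hbB)
  have hcard := Finset.card_sdiff_add_card_eq_card hsub
  rw [Finset.card_image_of_injective _ (add_left_injective b)] at hcard
  have hmem : ∀ z, z ∈ T ↔ IsSumOf B (N + 1) z ∧ ¬ IsSumOf B N (z - b) := by
    intro z
    simp only [hT, Finset.mem_sdiff, mem_sumset, Finset.mem_image, not_exists, not_and]
    refine and_congr_right fun _ => ⟨fun h h' => h _ h' (by ring), ?_⟩
    rintro h y hy rfl
    exact h (by simpa using hy)
  -- For congruent `z < z'` in `T`, `z' - b` is `z` plus copies of `b`, and `z'` itself lies in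
  -- `(N+1)B`; hence `z' - b ∈ NB`, contrary to `z' ∈ T`.
  have hinj : ∀ z ∈ T, ∀ z' ∈ T, z % b = z' % b → ¬ z < z' := by
    intro z hz z' hz' hzz hlt
    obtain ⟨i, hi⟩ : b ∣ z' - z := 
      Int.dvd_of_emod_eq_zero (Int.emod_eq_emod_iff_emod_sub_eq_zero.1 hzz.symm)
    have hi1 := WalkState.one_le_mult hb hi.symm (by omega)
    obtain ⟨j, rfl⟩ : ∃ j : ℕ, i = j + 1 := ⟨(i - 1).toNat, by omega⟩
    refine ((hmem z').1 hz').2 (IsSumOf.of_eventually hb h0 hbB hB hN (I := 1) (J := 1 + j) ?_ ?_)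
    · convert ((hmem z).1 hz).1.add_nat_mul hbB j using 1
      · omega
      · linarith
    · simpa using ((hmem z').1 hz').1
  -- The least element `z` of a class in `(N+1)B` lies in `T`: otherwise `z - b`, padded by `0`,
  -- would be smaller.
  have himage : T.image (· % b) = (sumset B (N + 1)).image (· % b) := by
    refine (Finset.image_subset_image Finset.sdiff_subset).antisymm ?_
    intro r hr
    obtain ⟨z₀, hz₀, hr₀⟩ := Finset.mem_image.1 hr
    obtain ⟨z, hz, hmin⟩ := ((sumset B (N + 1)).filter (· % b = r)).exists_min_image id
      ⟨z₀, by simp [hz₀, hr₀]⟩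
    rw [Finset.mem_filter] at hz
    refine Finset.mem_image.2 ⟨z, (hmem z).2 ⟨mem_sumset.1 hz.1, fun h => ?_⟩, hz.2⟩
    have := hmin (z - b) (Finset.mem_filter.2
      ⟨mem_sumset.2 (by simpa using h.add_mem h0), by simpa using hz.2⟩)
    simp at this
    omega
  rw [← image_emod_sumset_succ hb h0 hN, ← himage, Finset.card_image_of_injOn, ← hcard, add_comm]
  intro z hz z' hz' h
  exact le_antisymm (not_lt.1 (hinj z' hz' z hz h.symm)) (not_lt.1 (hinj z hz z' hz' h))

theorem card_sumset_add (hb : 0 < b) (h0 : (0 : ℤ) ∈ B) (hbB : b ∈ B)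
    (hB : ∀ x ∈ B, 0 ≤ x ∧ x ≤ b) {n : ℕ} (hn : b ≤ n + 1) (k : ℕ) :
    (sumset B (n + k)).card = (sumset B n).card + k * ((sumset B n).image (· % b)).card := by
  have himage : ∀ k : ℕ, (sumset B (n + k)).image (· % b) = (sumset B n).image (· % b) := by
    intro k
    induction k with
    | zero => rfl
    | succ k ih => rw [← add_assoc, image_emod_sumset_succ hb h0 (by push_cast; omega), ih]
  induction k with
  | zero => simp
  | succ k ih =>
    rw [← add_assoc, card_sumset_succ hb h0 hbB hB (by push_cast; omega), ih, himage]
    ring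

end Normalized

/-! ### Back to arbitrary `A` with extreme elements `l` and `u` -/

section General

variable {A : Finset ℤ} {l u : ℤ}

theorem card_sumset_translate (c : ℤ) (N : ℕ) :
    (sumset (A.image (c + ·)) N).card = (sumset A N).card := by
  have : sumset (A.image (c + ·)) N = (sumset A N).image (N * c + ·) := by
    ext x
    simp only [Finset.mem_image, mem_sumset]
    constructor
    · intro h
      refine ⟨N * -c + 1 * x, h.map_affine ?_, by ring⟩
      intro a ha
      obtain ⟨a, ha, rfl⟩ := Finset.mem_image.1 ha
      simpa using ha
    · rintro ⟨y, hy, rfl⟩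
      simpa using hy.map_affine (c := c) (e := 1) (B := A.image (c + ·))
        fun a ha => by simpa using ha
  rw [this, Finset.card_image_of_injective _ (add_right_injective _)]

theorem translate_mem_bounds (hA : ∀ a ∈ A, l ≤ a ∧ a ≤ u) :
    ∀ x ∈ A.image (-l + ·), 0 ≤ x ∧ x ≤ u - l := by
  intro x hx
  obtain ⟨a, ha, rfl⟩ := Finset.mem_image.1 hx
  have := hA a ha
  constructor <;> omega

theorem exists_linear_card_sumset (hlu : l < u) (hl : l ∈ A) (hu : u ∈ A)
    (hA : ∀ a ∈ A, l ≤ a ∧ a ≤ u) {n : ℕ} (hn : u - l ≤ n + 1) :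
    ∃ P : Polynomial ℚ, P.degree ≤ 1 ∧
      ∀ N : ℕ, n ≤ N → ((sumset A N).card : ℚ) = P.eval (N : ℚ) := by
  set B := A.image (-l + ·) with hB
  set ρ := ((sumset B n).image (· % (u - l))).card
  refine ⟨Polynomial.C (ρ : ℚ) * Polynomial.X + Polynomial.C ((sumset B n).card - n * ρ : ℚ),
    Polynomial.degree_linear_le, ?_⟩
  intro N hN
  obtain ⟨k, rfl⟩ := Nat.exists_eq_add_of_le hN
  rw [← card_sumset_translate (-l), card_sumset_add (b := u - l) (by omega)
    (Finset.mem_image.2 ⟨l, hl, by ring⟩) (Finset.mem_image.2 ⟨u, hu, by ring⟩)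
    (translate_mem_bounds hA) hn]
  simp only [Polynomial.eval_add, Polynomial.eval_mul, Polynomial.eval_C, Polynomial.eval_X]
  push_cast
  ring

/-- After translating by `-l`, the two hypotheses become the two edges of the grid in
`IsSumOf.of_eventually`, with `J = N₁` and `I = N₂`. -/
theorem IsSumOf.of_reflect (hlu : l < u) (hl : l ∈ A) (hu : u ∈ A)
    (hA : ∀ a ∈ A, l ≤ a ∧ a ≤ u) {N N₁ N₂ : ℕ} (hN : u - l ≤ N + 1) {x : ℤ}
    (h₁ : IsSumOf (reflect l A) N₁ (l * N - x)) (h₂ : IsSumOf (reflect u A) N₂ (u * N - x)) :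
    IsSumOf A N x := by
  set B := A.image (-l + ·) with hB
  have h0 : (0 : ℤ) ∈ B := Finset.mem_image.2 ⟨l, hl, by ring⟩
  have htop : u - l ∈ B := Finset.mem_image.2 ⟨u, hu, by ring⟩
  have h₁' : IsSumOf B (N + N₁) (x - l * N) := by
    convert (h₁.map_affine (c := 0) (e := -1) (B := B) ?_).add_nat_mul h0 N using 1
    · omega
    · ring
    · intro a ha
      obtain ⟨y, hy, rfl⟩ := Finset.mem_image.1 ha
      exact Finset.mem_image.2 ⟨y, hy, by ring⟩
  have h₂' : IsSumOf B (N + N₂) (x - l * N + (u - l) * N₂) := by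
    convert (h₂.map_affine (c := u - l) (e := -1) (B := B) ?_).add_nat_mul htop N using 1
    · omega
    · ring
    · intro a ha
      obtain ⟨y, hy, rfl⟩ := Finset.mem_image.1 ha
      exact Finset.mem_image.2 ⟨y, hy, by ring⟩
  have h := IsSumOf.of_eventually (by omega) h0 htop (translate_mem_bounds hA) hN h₁' h₂'
  convert h.map_affine (c := l) (e := 1) (B := A) ?_ using 1
  · ring
  · intro a ha
    obtain ⟨y, hy, rfl⟩ := Finset.mem_image.1 ha
    simpa using hy

theorem hull_eq_Icc (hl : l ∈ A) (hu : u ∈ A) (hA : ∀ a ∈ A, l ≤ a ∧ a ≤ u) :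
    hull A = Set.Icc (l : ℝ) u := by
  have hle : (l : ℝ) ≤ u := by exact_mod_cast (hA u hu).1
  refine (convexHull_min ?_ (convex_Icc _ _)).antisymm ?_
  · rintro _ ⟨a, ha, rfl⟩
    have := hA a ha
    exact ⟨Int.cast_le.2 this.1, Int.cast_le.2 this.2⟩
  · rw [← segment_eq_Icc hle]
    exact (convex_convexHull ℝ _).segment_subset (subset_convexHull ℝ _ ⟨l, hl, rfl⟩)
      (subset_convexHull ℝ _ ⟨u, hu, rfl⟩)

theorem mul_mem_cone {B : Finset ℤ} {g : ℤ} (hg : g ∈ B) {r : ℝ} (hr : 0 ≤ r) :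
    r * g ∈ cone B := by
  refine ⟨fun z => if z = g then r else 0, fun a _ => ?_, ?_⟩
  · dsimp only
    split_ifs
    · exact hr
    · exact le_rfl
  · simp [ite_mul, hg]

theorem lattice_diffs_le {a : ℤ} : lattice (diffs A) ≤ lattice (reflect a A) := by
  refine (AddSubgroup.closure_le _).2 ?_
  intro d hd
  obtain ⟨x, hx, y, hy, rfl⟩ := Finset.mem_image₂.1 hd
  have hmem : ∀ z ∈ A, a - z ∈ lattice (reflect a A) := fun z hz =>
    AddSubgroup.subset_closure (Finset.mem_image_of_mem _ hz)
  have := sub_mem (hmem y hy) (hmem x hx)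
  rwa [sub_sub_sub_cancel_left] at this

theorem IsSumOf.sub_mem_lattice {N : ℕ} {x a : ℤ} (h : IsSumOf A N x) (ha : a ∈ A) :
    x - a * N ∈ lattice (diffs A) := by
  obtain ⟨W, hW, -, hs⟩ := h.map_affine (c := -a) (e := 1) (B := diffs A)
    fun y hy => Finset.mem_image₂.2 ⟨y, hy, a, ha, by ring⟩
  rw [show x - a * N = W.sum by rw [hs]; ring]
  exact AddSubgroup.multiset_sum_mem _ _ fun d hd => AddSubgroup.subset_closure (hW d hd)

theorem IsSumOf.bounds (hA : ∀ a ∈ A, l ≤ a ∧ a ≤ u) {N : ℕ} {x : ℤ} (h : IsSumOf A N x) :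
    l * N ≤ x ∧ x ≤ u * N := by
  obtain ⟨W, hW, rfl, rfl⟩ := h
  have h1 := Multiset.sum_le_card_nsmul W u fun a ha => (hA a (hW a ha)).2
  have h2 := Multiset.card_nsmul_le_sum (s := W) (a := l) fun a ha => (hA a (hW a ha)).1
  rw [nsmul_eq_mul] at h1 h2
  constructor <;> linarith

theorem mem_sums_of_notMem_exceptional {N : ℕ} {a₀ a x d : ℤ} (ha₀ : a₀ ∈ A)
    (hd : d ∈ lattice (diffs A)) (hx : x = a₀ * N + d)
    (hcone : ((a * N - x : ℤ) : ℝ) ∈ cone (reflect a A))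
    (h : a * N - x ∉ exceptional (reflect a A)) : a * N - x ∈ sums (reflect a A) := by
  by_contra hs
  refine h ⟨hcone, ?_, hs⟩
  have h1 : a - a₀ ∈ lattice (reflect a A) :=
    AddSubgroup.subset_closure (Finset.mem_image_of_mem _ ha₀)
  have := sub_mem (nsmul_mem h1 N) (lattice_diffs_le (a := a) hd)
  rw [nsmul_eq_mul] at this
  rwa [hx, show a * N - (a₀ * N + d) = N * (a - a₀) - d by ring]

theorem hasStructure (hlu : l < u) (hl : l ∈ A) (hu : u ∈ A) (hA : ∀ a ∈ A, l ≤ a ∧ a ≤ u)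
    {N : ℕ} (hN : u - l ≤ N + 1) (hN1 : 1 ≤ N) : HasStructure A N := by
  intro a₀ ha₀
  have hNpos : (0 : ℝ) < N := by exact_mod_cast hN1
  ext x
  rw [Finset.mem_coe, mem_sumset]
  constructor
  · intro h
    have hx := h.bounds hA
    refine ⟨⟨x / N, ?_, by field_simp⟩, ⟨x - a₀ * N, h.sub_mem_lattice ha₀, by ring⟩, ?_⟩
    · rw [hull_eq_Icc hl hu hA, Set.mem_Icc, le_div_iff₀ hNpos, div_le_iff₀ hNpos]
      exact ⟨by exact_mod_cast hx.1, by exact_mod_cast hx.2⟩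
    · rintro ⟨a, -, e, he, rfl⟩
      refine he.2.2 ⟨N, hN1, mem_sumset.2 ?_⟩
      convert h.map_affine (c := a) (e := -1) (B := reflect a A) ?_ using 1
      · ring
      · exact fun y hy => Finset.mem_image.2 ⟨y, hy, by ring⟩
  · rintro ⟨⟨y, hy, hxy⟩, ⟨d, hd, hx⟩, hexc⟩
    have hlu' : (0 : ℝ) < u - l := by
      rw [sub_pos]
      exact_mod_cast hlu
    have hext := Set.extremePoints_Icc (a := (l : ℝ)) (b := u) (by linarith)
    -- Only `l` and `u` are extreme, so avoiding the two exceptional sets is exactly what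
    -- `IsSumOf.of_reflect` needs, once the cone and lattice conditions are checked.
    rw [hull_eq_Icc hl hu hA] at hy hexc
    rw [hext] at hexc
    have hlow := mul_le_mul_of_nonneg_left hy.1 hNpos.le
    have hupp := mul_le_mul_of_nonneg_left hy.2 hNpos.le
    obtain ⟨N₁, -, h₁⟩ := mem_sums_of_notMem_exceptional (a := l) ha₀ hd hx
      (by
        convert mul_mem_cone (B := reflect l A) (g := l - u) (Finset.mem_image_of_mem _ hu)
          (r := (x - l * N) / (u - l)) (div_nonneg (by linarith) hlu'.le) using 1
        push_cast
        field_simp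
        ring)
      fun h => hexc ⟨l, by simp, _, h, by ring⟩
    obtain ⟨N₂, -, h₂⟩ := mem_sums_of_notMem_exceptional (a := u) ha₀ hd hx
      (by
        convert mul_mem_cone (B := reflect u A) (g := u - l) (Finset.mem_image_of_mem _ hl)
          (r := (u * N - x) / (u - l)) (div_nonneg (by linarith) hlu'.le) using 1
        push_cast
        field_simp)
      fun h => hexc ⟨u, by simp, _, h, by ring⟩
    exact IsSumOf.of_reflect hlu hl hu hA hN (mem_sumset.1 h₁) (mem_sumset.1 h₂)

theorem width_eq (hl : l ∈ A) (hu : u ∈ A) (hA : ∀ a ∈ A, l ≤ a ∧ a ≤ u) :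
    (width A : ℤ) = u - l := by
  have h1 : (u - l).natAbs ≤ width A :=
    Finset.le_sup (f := fun p : ℤ × ℤ => (p.1 - p.2).natAbs) (Finset.mk_mem_product hu hl)
  have h2 : width A ≤ (u - l).natAbs := by
    refine Finset.sup_le fun p hp => ?_
    have hp' := Finset.mem_product.1 hp
    have := hA _ hp'.1
    have := hA _ hp'.2
    omega
  have := hA u hu
  omega

theorem volume_hull (hl : l ∈ A) (hu : u ∈ A) (hA : ∀ a ∈ A, l ≤ a ∧ a ≤ u) :
    MeasureTheory.volume (hull A) = (width A : ENNReal) := by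
  rw [hull_eq_Icc hl hu hA, Real.volume_Icc, ← ENNReal.ofReal_natCast]
  congr 1
  exact_mod_cast (width_eq hl hu hA).symm

end General

end SumsetThreshold

theorem lemma2p1 (A : Finset ℤ) (hgcd : A.gcd id = 1) (hcard : 3 ≤ A.card) :
    (SumsetThreshold.NStr A ≤ ((SumsetThreshold.width A - 1 : ℕ) : ℕ∞) ∧
      SumsetThreshold.NKh A ≤ ((SumsetThreshold.width A - 1 : ℕ) : ℕ∞)) ∧
    ((SumsetThreshold.NStr A : ENNReal) ≤
        (Nat.factorial 1 : ENNReal) * MeasureTheory.volume (SumsetThreshold.hull A) ∧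
      (SumsetThreshold.NKh A : ENNReal) ≤
        (Nat.factorial 1 : ENNReal) * MeasureTheory.volume (SumsetThreshold.hull A)) := by
  have hne : A.Nonempty := Finset.card_pos.1 (by omega)
  obtain ⟨l, hl, hmin⟩ := A.exists_min_image id hne
  obtain ⟨u, hu, hmax⟩ := A.exists_max_image id hne
  have hA : ∀ a ∈ A, l ≤ a ∧ a ≤ u := fun a ha => ⟨hmin a ha, hmax a ha⟩
  have hw := SumsetThreshold.width_eq hl hu hA
  -- Three integers span width at least `2`, so `width A - 1` is a positive candidate for both
  -- infima.
  have hw2 : 2 ≤ u - l := by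
    have := Finset.card_le_card (fun a ha => Finset.mem_Icc.2 (hA a ha) : A ⊆ Finset.Icc l u)
    rw [Int.card_Icc] at this
    omega
  have hStr : SumsetThreshold.NStr A ≤ ((SumsetThreshold.width A - 1 : ℕ) : ℕ∞) :=
    iInf₂_le _ ⟨by omega, fun N hN =>
      SumsetThreshold.hasStructure (by omega) hl hu hA (by omega) (by omega)⟩
  have hKh : SumsetThreshold.NKh A ≤ ((SumsetThreshold.width A - 1 : ℕ) : ℕ∞) :=
    iInf₂_le _ ⟨by omega,
      SumsetThreshold.exists_linear_card_sumset (by omega) hl hu hA (by omega)⟩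
  have hcast : ∀ n : ℕ∞, n ≤ ((SumsetThreshold.width A - 1 : ℕ) : ℕ∞) → (n : ENNReal) ≤
      (Nat.factorial 1 : ENNReal) * MeasureTheory.volume (SumsetThreshold.hull A) := by
    intro n hn
    rw [SumsetThreshold.volume_hull hl hu hA, Nat.factorial_one, Nat.cast_one, one_mul,
      ← ENat.toENNReal_coe]
    exact ENat.toENNReal_mono (hn.trans (by exact_mod_cast Nat.sub_le _ _))
  exact ⟨⟨hStr, hKh⟩, hcast _ hStr, hcast _ hKh⟩
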